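/- Let $n\ge 1$, let $\mathcal Z\subseteq\mathbb R^{d_z}$, $c_z\in\mathbb R^{d_z}$, $q\in\mathbb R^{d_\omega}$, $W\in\mathbb R^{M\times d_\omega}$, and let $T(z)\in\mathbb R^{M\times d_y}$, $h(z)\in\mathbb R^M$ be affine in $z$. For $y\in\mathbb R^{d_y}$ let $$H(z,y)=\inf_{\omega\in\mathbb R^{d_\omega}}\{q^\top\omega: W\omega\ge T(z)y+h(z)\}\in[-\infty,+\infty]$$ ($+\infty$ if infeasible). Given observations $(x^k,z^k,y^k)_{k=1}^n$ and a regression estimate $\hat f_n:\mathbb R^{d_x}\times\mathbb R^{d_z}\to\mathbb R^{d_y}$, let $\hat\epsilon_n^k=y^k-\hat f_n(x^k,z^k)$ and $\hat L_n=\frac1n\sum_{k=1}^n\delta_{\hat\epsilon_n^k}$. Fix a covariate $x$ and a radius $\xi_n\ge 0$, and let $\mathcal L_n$ be the set of probability distributions $L$ on $\mathbb R^{d_y}$ whose 1-Wasserstein distance to $\hat L_n$, with respect to the $\ell_1$ norm, is at most $\xi_n$. Consider the two-stage distributionally robust problem $$\text{(R)}\qquad \min_{z\in\mathcal Z}\ v(z),\qquad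 v(z):=c_z^\top z+\sup_{L\in\mathcal L_n}\mathbb E_{\epsilon\sim L}\bigl[H(z,\hat f_n(x,z)+\epsilon)\bigr],$$ where expectations are extended-real valued. Assume sufficiently expensive recourse, i.e. the dual of the second-stage problem is feasible: there is $\pi\ge 0$ with $W^\top\pi=q$. If $\xi_n=0$, assume in addition relatively complete recourse, i.e. the second-stage problem is feasible for all $z\in\mathcal Z$ and $y\in\mathbb R^{d_y}$. Then (R) can be reformulated as $$\begin{aligned}\text{(F)}\qquad \min_{z,\lambda,\phi,\psi,\omega}\quad & c_z^\top z+\lambda\xi_n+\frac1n\sum_{k=1}^n q^\top\omega_k\\ \text{s.t.}\quad & q^\top\phi_m\le\lambda,\quad q^\top\psi_m\le\lambda, && m=1,\dots,d_y,\\ & T(z)e_m\le W\phi_m,\quad -T(z)e_m\le W\psi_m, && m=1,\dots,d_y,\\ & W\omega_k\ge T(z)\bigl(\hat f_n(x,z)+\hat\epsilon_n^k\bigr)+h(z), && k=1,\dots,n,\\ & z\in\mathcal Z,\ \lambda\ge 0,\ \phi_m,\psi_m,\omega_k\in\mathbb R^{d_\omega}.\end{aligned}$$ That is: the optimal values (infima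 in $[-\infty,+\infty]$, $+\infty$ for an infeasible problem) of (R) and (F) coincide; every feasible point of (F) with first-stage decision $z$ has objective value at least $v(z)$; for every $z\in\mathcal Z$ with $v(z)<+\infty$ some feasible point of (F) with first-stage decision $z$ has objective value exactly $v(z)$; and $z$ is an optimal solution of (R) with $v(z)<+\infty$ if and only if $z$ is the first-stage component of an optimal solution of (F). -/

import Mathlib

open MeasureTheory
open scoped ENNReal Matrix

noncomputable section

namespace ResidualDRO

/-- The data of a two-stage problem with right-hand side uncertainty and a fitted regression model:
dimensions `dx` (covariate), `dy` (uncertainty), `dz` (first stage), `dw` (second stage),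
`M` second-stage constraints and `n` observations. -/
structure TwoStage (dx dy dz dw M n : ℕ) where
  /-- first-stage feasible set -/
  Z : Set (Fin dz → ℝ)
  /-- first-stage cost vector -/
  c : Fin dz → ℝ
  /-- second-stage cost vector -/
  q : Fin dw → ℝ
  /-- recourse matrix -/
  W : Matrix (Fin M) (Fin dw) ℝ
  /-- technology matrix, affine in the first-stage decision -/
  T : (Fin dz → ℝ) →ᵃ[ℝ] Matrix (Fin M) (Fin dy) ℝ
  /-- right-hand side, affine in the first-stage decision -/
  h : (Fin dz → ℝ) →ᵃ[ℝ] (Fin M → ℝ)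
  /-- regression estimate, an arbitrary function of covariate and decision -/
  fhat : (Fin dx → ℝ) → (Fin dz → ℝ) → (Fin dy → ℝ)
  /-- observed covariates -/
  xObs : Fin n → Fin dx → ℝ
  /-- observed decisions -/
  zObs : Fin n → Fin dz → ℝ
  /-- observed values of the uncertain parameter -/
  yObs : Fin n → Fin dy → ℝ
  /-- the new covariate -/
  x : Fin dx → ℝ
  /-- radius of the Wasserstein ball -/
  ξ : ℝ

/-- The `ℓ¹` distance on `ℝ^d`. -/
def l1Dist {d : ℕ} (a b : Fin d → ℝ) : ℝ := ∑ i, |a i - b i|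

/-- The couplings of two measures on `ℝ^d`. -/
def couplings {d : ℕ} (μ ν : Measure (Fin d → ℝ)) :
    Set (Measure ((Fin d → ℝ) × (Fin d → ℝ))) :=
  {γ | γ.map Prod.fst = μ ∧ γ.map Prod.snd = ν}

/-- The 1-Wasserstein distance with respect to the `ℓ¹` norm, with values in `[0, ∞]`. -/
def wasserstein1 {d : ℕ} (μ ν : Measure (Fin d → ℝ)) : ℝ≥0∞ :=
  ⨅ γ ∈ couplings μ ν, ∫⁻ p, ENNReal.ofReal (l1Dist p.1 p.2) ∂γ

/-- The expectation `E[g⁺] - E[g⁻]` of an extended-real-valued function. -/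
def expectation {d : ℕ} (L : Measure (Fin d → ℝ)) (g : (Fin d → ℝ) → EReal) : EReal :=
  ((∫⁻ e, (g e).toENNReal ∂L : ℝ≥0∞) : EReal) - ((∫⁻ e, (-(g e)).toENNReal ∂L : ℝ≥0∞) : EReal)

namespace TwoStage

variable {dx dy dz dw M n : ℕ} (P : TwoStage dx dy dz dw M n)

/-- The feasible set of the second-stage problem at decision `z` and realization `y`. -/
def secondStageFeasible (z : Fin dz → ℝ) (y : Fin dy → ℝ) : Set (Fin dw → ℝ) :=
  {w | P.T z *ᵥ y + P.h z ≤ P.W *ᵥ w}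

/-- The second-stage optimal value `H(z, y)`, in the extended reals: `⊤` when the second-stage
problem is infeasible and `⊥` when it is unbounded below. -/
def H (z : Fin dz → ℝ) (y : Fin dy → ℝ) : EReal :=
  ⨅ w ∈ P.secondStageFeasible z y, ((P.q ⬝ᵥ w : ℝ) : EReal)

/-- The feasible set of the dual of the second-stage problem,
`max {πᵀ (T(z) y + h(z)) : Wᵀ π = q, π ≥ 0}`; it involves neither `z` nor `y`. -/
def dualFeasible : Set (Fin M → ℝ) :=
  {p | 0 ≤ p ∧ P.Wᵀ *ᵥ p = P.q}

/-- Sufficiently expensive recourse: the dual of the second-stage problem is feasible. -/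
def SufficientlyExpensiveRecourse : Prop := P.dualFeasible.Nonempty

/-- Relatively complete recourse: the second-stage problem is feasible for every first-stage
decision in `Z` and every realization in `ℝ^dy`. -/
def RelativelyCompleteRecourse : Prop :=
  ∀ z ∈ P.Z, ∀ y : Fin dy → ℝ, (P.secondStageFeasible z y).Nonempty

/-- The empirical residuals `yᵏ - f̂(xᵏ, zᵏ)`. -/
def residual (k : Fin n) : Fin dy → ℝ := P.yObs k - P.fhat (P.xObs k) (P.zObs k)

/-- The empirical distribution of the residuals. -/
def empirical : Measure (Fin dy → ℝ) :=
  (n : ℝ≥0∞)⁻¹ • ∑ k : Fin n, Measure.dirac (P.residual k)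

/-- The Wasserstein ball around the empirical residual distribution. -/
def ambiguitySet : Set (Measure (Fin dy → ℝ)) :=
  {L | IsProbabilityMeasure L ∧ wasserstein1 L P.empirical ≤ ENNReal.ofReal P.ξ}

/-- The worst-case objective `cᵀ z + sup_L E_L[H(z, f̂(x, z) + ε)]`. -/
def robustObj (z : Fin dz → ℝ) : EReal :=
  ((P.c ⬝ᵥ z : ℝ) : EReal) +
    ⨆ L ∈ P.ambiguitySet, expectation L (fun e => P.H z (P.fhat P.x z + e))

/-- The optimal value of the distributionally robust problem. -/
def robustValue : EReal := ⨅ z ∈ P.Z, P.robustObj z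

/-- Optimal solutions of the distributionally robust problem (with finite cost). -/
def IsRobustOptimal (z : Fin dz → ℝ) : Prop :=
  z ∈ P.Z ∧ P.robustObj z < ⊤ ∧ ∀ z' ∈ P.Z, P.robustObj z ≤ P.robustObj z'

end TwoStage

/-- The variables `(z, λ, φ, ψ, ω)` of the finite problem. -/
structure Vars (dy dz dw n : ℕ) where
  z : Fin dz → ℝ
  lam : ℝ
  φ : Fin dy → Fin dw → ℝ
  ψ : Fin dy → Fin dw → ℝ
  ω : Fin n → Fin dw → ℝ

namespace TwoStage

variable {dx dy dz dw M n : ℕ} (P : TwoStage dx dy dz dw M n)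

/-- The constraints of the finite problem. -/
structure ReformFeasible (v : Vars dy dz dw n) : Prop where
  z_mem : v.z ∈ P.Z
  lam_nonneg : 0 ≤ v.lam
  cost_φ : ∀ m, P.q ⬝ᵥ v.φ m ≤ v.lam
  cost_ψ : ∀ m, P.q ⬝ᵥ v.ψ m ≤ v.lam
  constr_φ : ∀ m, P.T v.z *ᵥ Pi.single m (1 : ℝ) ≤ P.W *ᵥ v.φ m
  constr_ψ : ∀ m, -(P.T v.z *ᵥ Pi.single m (1 : ℝ)) ≤ P.W *ᵥ v.ψ m
  secondStage : ∀ k, P.T v.z *ᵥ (P.fhat P.x v.z + P.residual k) + P.h v.z ≤ P.W *ᵥ v.ω k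

/-- The objective of the finite problem. -/
def reformObj (v : Vars dy dz dw n) : ℝ :=
  P.c ⬝ᵥ v.z + v.lam * P.ξ + (1 / (n : ℝ)) * ∑ k, P.q ⬝ᵥ v.ω k

/-- The optimal value of the finite problem (`⊤` when it is infeasible). -/
def reformValue : EReal :=
  ⨅ (v : Vars dy dz dw n) (_ : P.ReformFeasible v), ((P.reformObj v : ℝ) : EReal)

/-- Optimal solutions of the finite problem. -/
def IsReformOptimal (v : Vars dy dz dw n) : Prop :=
  P.ReformFeasible v ∧ ∀ v', P.ReformFeasible v' → P.reformObj v ≤ P.reformObj v'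

end TwoStage

end ResidualDRO

end

/-! Linear programming duality shows that the columns `φ m`, `ψ m` of cost at most `λ` exist exactly
when every dual feasible `p` satisfies `|p ⬝ᵥ T(z) e_m| ≤ λ`. So `λ` bounds the `ℓ¹` slope of `H(z,
·)`, and the columns certify the bound on the primal side.

Upper bound (`robustObj_le_reformObj`): the columns repair a recourse decision when the realization
moves, so `H(z, ·)` is finite and `λ`-Lipschitz, and Kantorovich's inequality bounds every
expectation over the ball by the empirical mean plus `λ ξ`.

Lower bound (`mean_add_slope_le_worstCase`): for `ξ > 0`, move mass `θ` a distance `ξ / θ` along a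
unit vector. This stays in the ball and, as `θ → 0`, collects `ξ` times the slope of any dual affine
minorant. A finite worst case therefore bounds all dual slopes by (worst case - mean) / `ξ`, and
strong duality turns this bound into columns. For `ξ = 0` the multiplier is free, and relatively
complete recourse supplies the columns. -/

noncomputable section

namespace ResidualDRO

/-! ### Linear programming duality -/

/-- **Farkas' lemma** for finitely many linear functionals on a real vector space. -/
theorem exists_nonneg_sum_eq_of_forall_nonneg {V : Type*} [AddCommGroup V] [Module ℝ V] :
    ∀ {m : ℕ} (a : Fin m → V →ₗ[ℝ] ℝ) (b : V →ₗ[ℝ] ℝ),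
      (∀ x, (∀ i, 0 ≤ a i x) → 0 ≤ b x) →
      ∃ y : Fin m → ℝ, 0 ≤ y ∧ ∀ x, b x = ∑ i, y i * a i x := by
  intro m
  induction m with
  | zero =>
    intro a b h
    refine ⟨0, le_rfl, fun x => ?_⟩
    have h₁ := h x (fun i => i.elim0)
    have h₂ := h (-x) (fun i => i.elim0)
    rw [map_neg] at h₂
    simp only [Finset.univ_eq_empty, Finset.sum_empty]
    linarith
  | succ m ih =>
    intro a b h
    by_cases hb : ∀ x, (∀ i : Fin m, 0 ≤ a i.castSucc x) → 0 ≤ b x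
    · obtain ⟨y, hy, hyb⟩ := ih (fun i => a i.castSucc) b hb
      refine ⟨Fin.snoc y 0, fun i => ?_, fun x => ?_⟩
      · refine Fin.lastCases ?_ (fun i => ?_) i
        · simp
        · simpa using hy i
      · simp [Fin.sum_univ_castSucc, hyb x]
    · push Not at hb
      obtain ⟨x₁, hx₁, hbx₁⟩ := hb
      have hlast : a (Fin.last m) x₁ < 0 := by
        by_contra hcon
        push Not at hcon
        refine absurd (h x₁ fun i => ?_) (not_le.mpr hbx₁)
        exact Fin.lastCases hcon hx₁ i
      obtain ⟨x₀, hx₀, hbx₀, hl⟩ : ∃ x₀, (∀ i : Fin m, 0 ≤ a i.castSucc x₀) ∧ b x₀ < 0 ∧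
          a (Fin.last m) x₀ = -1 := by
        have hs : 0 < (-(a (Fin.last m) x₁))⁻¹ := inv_pos.mpr (by linarith)
        refine ⟨(-(a (Fin.last m) x₁))⁻¹ • x₁, fun i => ?_, ?_, ?_⟩
        · simpa only [map_smul, smul_eq_mul] using mul_nonneg hs.le (hx₁ i)
        · simpa only [map_smul, smul_eq_mul] using mul_neg_of_pos_of_neg hs hbx₁
        · rw [map_smul, smul_eq_mul, inv_mul_eq_div, div_neg, div_self hlast.ne]
      obtain ⟨y, hy, hyb⟩ := ih
        -- The functionals are composed with `x ↦ x + a (Fin.last m) x • x₀`, the projection onto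
        -- the kernel of the last functional along `x₀`; there the last constraint holds trivially.
        (fun i => a i.castSucc + a i.castSucc x₀ • a (Fin.last m))
        (b + b x₀ • a (Fin.last m)) (fun x hx => by
          have key := h (x + a (Fin.last m) x • x₀) (fun i => by
            refine Fin.lastCases ?_ (fun i => ?_) i
            · simp [hl]
            · have := hx i
              simp only [LinearMap.add_apply, LinearMap.smul_apply, smul_eq_mul] at this
              simp only [map_add, map_smul, smul_eq_mul]
              linarith)
          simp only [map_add, map_smul, smul_eq_mul] at key
          simp only [LinearMap.add_apply, LinearMap.smul_apply, smul_eq_mul]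
          linarith)
      refine ⟨Fin.snoc y (∑ i, y i * a i.castSucc x₀ - b x₀), fun i => ?_, fun x => ?_⟩
      · refine Fin.lastCases ?_ (fun i => ?_) i
        · have : 0 ≤ ∑ i, y i * a i.castSucc x₀ :=
            Finset.sum_nonneg fun i _ => mul_nonneg (hy i) (hx₀ i)
          simp only [Fin.snoc_last, Pi.zero_apply]
          linarith
        · simpa using hy i
      · have := hyb x
        simp only [LinearMap.add_apply, LinearMap.smul_apply, smul_eq_mul, mul_add,
          Finset.sum_add_distrib] at this
        simp only [Fin.sum_univ_castSucc, Fin.snoc_castSucc, Fin.snoc_last, sub_mul,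
          Finset.sum_mul]
        simp only [mul_assoc] at this ⊢
        linarith

/-- Weak duality for linear programs. -/
theorem dotProduct_le_of_dual_feasible {M d : ℕ} {W : Matrix (Fin M) (Fin d) ℝ}
    {q : Fin d → ℝ} {u p : Fin M → ℝ} {w : Fin d → ℝ}
    (hp : 0 ≤ p) (hpq : Wᵀ *ᵥ p = q) (hw : u ≤ W *ᵥ w) : p ⬝ᵥ u ≤ q ⬝ᵥ w := by
  calc p ⬝ᵥ u ≤ p ⬝ᵥ W *ᵥ w := dotProduct_le_dotProduct_of_nonneg_left hw hp
    _ = q ⬝ᵥ w := by rw [Matrix.dotProduct_mulVec, ← hpq, Matrix.mulVec_transpose]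

/-- Strong duality for linear programs: a bound on the dual values is attained by a primal
feasible point. -/
theorem exists_primal_le_of_forall_dual_le {M d : ℕ} (W : Matrix (Fin M) (Fin d) ℝ)
    (q : Fin d → ℝ) (u : Fin M → ℝ) (C : ℝ) {p₀ : Fin M → ℝ}
    (hp₀ : 0 ≤ p₀) (hp₀q : Wᵀ *ᵥ p₀ = q)
    (hC : ∀ p, 0 ≤ p → Wᵀ *ᵥ p = q → p ⬝ᵥ u ≤ C) :
    ∃ w, u ≤ W *ᵥ w ∧ q ⬝ᵥ w ≤ C := by
  by_contra hcon
  push Not at hcon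
  let qf : (Fin d → ℝ) →ₗ[ℝ] ℝ := dotProductBilin ℝ ℝ q
  -- Homogenization with an extra variable `t`: the rows are `W x - t u` and `C t - q ⬝ᵥ x`. If no
  -- primal point has cost at most `C`, nonnegativity of all rows forces `t ≤ 0`.
  let a : Fin (M + 1) → ((Fin d → ℝ) × ℝ) →ₗ[ℝ] ℝ := Fin.snoc
    (fun i => (LinearMap.proj i ∘ₗ W.mulVecLin) ∘ₗ LinearMap.fst ℝ _ ℝ - u i • LinearMap.snd ℝ _ ℝ)
    (C • LinearMap.snd ℝ _ ℝ - qf ∘ₗ LinearMap.fst ℝ _ ℝ)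
  have ha : ∀ (i : Fin M) x, a i.castSucc x = (W *ᵥ x.1) i - u i * x.2 := fun i x => by
    simp [a]
  have hal : ∀ x, a (Fin.last M) x = C * x.2 - q ⬝ᵥ x.1 := fun x => by
    simp [a, qf]
  obtain ⟨y, hy, hyb⟩ := exists_nonneg_sum_eq_of_forall_nonneg a (-LinearMap.snd ℝ _ ℝ)
    (fun x hx => by
      by_contra hneg
      have hpos : 0 < x.2 := by simpa using hneg
      have hl := hx (Fin.last M)
      rw [hal] at hl
      refine absurd (hcon (x.2⁻¹ • x.1) fun i => ?_) (not_lt.mpr ?_)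
      · have := hx i.castSucc
        rw [ha] at this
        rw [Matrix.mulVec_smul, Pi.smul_apply, smul_eq_mul, inv_mul_eq_div, le_div_iff₀ hpos]
        linarith
      · rw [dotProduct_smul, smul_eq_mul, inv_mul_eq_div, div_le_iff₀ hpos]
        linarith)
  set δ := y (Fin.last M)
  have hδ : 0 ≤ δ := hy _
  let π : Fin M → ℝ := fun i => y i.castSucc
  have hπ : 0 ≤ π := fun i => hy _
  have hval : C * δ + 1 = π ⬝ᵥ u := by
    have := hyb (0, 1)
    simp only [Fin.sum_univ_castSucc, ha, hal] at this
    simp only [LinearMap.neg_apply, LinearMap.snd_apply, Matrix.mulVec_zero, Pi.zero_apply,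
      mul_one, zero_sub, mul_neg, Finset.sum_neg_distrib, dotProduct_zero, sub_zero] at this
    simp only [dotProduct, π]
    linarith
  have hgrad : Wᵀ *ᵥ π = δ • q := by
    refine dotProduct_eq _ _ fun w => ?_
    have := hyb (w, 0)
    simp only [Fin.sum_univ_castSucc, ha, hal] at this
    simp only [LinearMap.neg_apply, LinearMap.snd_apply, neg_zero, mul_zero, sub_zero,
      zero_sub] at this
    rw [Matrix.mulVec_transpose, ← Matrix.dotProduct_mulVec, smul_dotProduct, smul_eq_mul]
    simp only [dotProduct, π] at this ⊢
    linarith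
  -- If `δ = 0`, then `π` is a recession direction of the dual along which the value grows at rate
  -- 1, and the step from `p₀` reaches `C + 1`. Otherwise `π / δ` is dual feasible with value `C + 1
  -- / δ`.
  rcases hδ.eq_or_lt with h0 | hpos
  · rw [← h0, zero_smul] at hgrad
    rw [← h0, mul_zero, zero_add] at hval
    have h₀ := hC p₀ hp₀ hp₀q
    have := hC (p₀ + (C - p₀ ⬝ᵥ u + 1) • π)
      (add_nonneg hp₀ (smul_nonneg (by linarith) hπ))
      (by rw [Matrix.mulVec_add, Matrix.mulVec_smul, hgrad, hp₀q, smul_zero, add_zero])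
    rw [add_dotProduct, smul_dotProduct, ← hval, smul_eq_mul] at this
    linarith
  · have := hC (δ⁻¹ • π) (smul_nonneg (inv_nonneg.mpr hδ) hπ)
      (by rw [Matrix.mulVec_smul, hgrad, inv_smul_smul₀ hpos.ne'])
    rw [smul_dotProduct, ← hval, smul_eq_mul, inv_mul_eq_div, div_le_iff₀ hpos] at this
    linarith

/-! ### Uniform distributions on finite families -/

/-- The uniform distribution on a finite family of points. -/
def uniformDirac {α : Type*} [MeasurableSpace α] {n : ℕ} (x : Fin n → α) : Measure α :=
  (n : ℝ≥0∞)⁻¹ • ∑ k, Measure.dirac (x k)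

section uniformDirac

variable {α β : Type*} [MeasurableSpace α] [MeasurableSpace β] {n : ℕ} (x : Fin n → α)

theorem isProbabilityMeasure_uniformDirac (hn : 0 < n) : IsProbabilityMeasure (uniformDirac x) := by
  constructor
  have h0 : (n : ℝ≥0∞) ≠ 0 := by exact_mod_cast hn.ne'
  simp [uniformDirac, ENNReal.inv_mul_cancel h0 (ENNReal.natCast_ne_top n)]

theorem map_uniformDirac {f : α → β} (hf : Measurable f) :
    (uniformDirac x).map f = uniformDirac (f ∘ x) := by
  rw [uniformDirac, Measure.map_smul, ← Measure.mapₗ_apply_of_measurable hf, map_sum]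
  simp [uniformDirac, Measure.mapₗ_apply_of_measurable hf, Measure.map_dirac' hf]

theorem lintegral_uniformDirac [MeasurableSingletonClass α] (f : α → ℝ≥0∞) :
    ∫⁻ a, f a ∂(uniformDirac x) = (n : ℝ≥0∞)⁻¹ * ∑ k, f (x k) := by
  rw [uniformDirac, lintegral_smul_measure, lintegral_finsetSum_measure]
  simp

theorem integrable_uniformDirac [MeasurableSingletonClass α] (hn : 0 < n) (f : α → ℝ) :
    Integrable f (uniformDirac x) := by
  refine Integrable.smul_measure ?_ (ENNReal.inv_ne_top.mpr (by exact_mod_cast hn.ne'))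
  exact integrable_finsetSum_measure.mpr fun k _ => integrable_dirac (by simp)

theorem integral_uniformDirac [MeasurableSingletonClass α] (f : α → ℝ) :
    ∫ a, f a ∂(uniformDirac x) = 1 / (n : ℝ) * ∑ k, f (x k) := by
  rw [uniformDirac, integral_smul_measure,
    integral_finsetSum_measure fun k _ => integrable_dirac (by simp)]
  simp

end uniformDirac

/-! ### The `ℓ¹` distance -/

section Distance

variable {d : ℕ}

theorem l1Dist_nonneg (a b : Fin d → ℝ) : 0 ≤ l1Dist a b :=
  Finset.sum_nonneg fun _ _ => abs_nonneg _

theorem l1Dist_comm (a b : Fin d → ℝ) : l1Dist a b = l1Dist b a :=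
  Finset.sum_congr rfl fun _ _ => abs_sub_comm _ _

theorem l1Dist_le (a b : Fin d → ℝ) : l1Dist a b ≤ d * dist a b := by
  calc l1Dist a b ≤ ∑ _i : Fin d, dist a b :=
        Finset.sum_le_sum fun i _ => dist_le_pi_dist a b i
    _ = d * dist a b := by simp

theorem continuous_l1Dist : Continuous fun p : (Fin d → ℝ) × (Fin d → ℝ) => l1Dist p.1 p.2 := by
  unfold l1Dist
  fun_prop

theorem continuous_of_le_l1Dist {g : (Fin d → ℝ) → ℝ} {c : ℝ} (hc : 0 ≤ c)
    (hg : ∀ a b, g a ≤ g b + c * l1Dist a b) : Continuous g := by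
  refine (LipschitzWith.of_le_add_mul (Real.toNNReal (c * d)) fun a b => ?_).continuous
  rw [Real.coe_toNNReal _ (by positivity), mul_assoc]
  exact (hg a b).trans (by gcongr; exact l1Dist_le a b)

end Distance

/-! ### Extended expectations and Wasserstein estimates -/

section Expectation

variable {d : ℕ} {L : Measure (Fin d → ℝ)}

theorem expectation_mono {f g : (Fin d → ℝ) → EReal} (h : f ≤ g) :
    expectation L f ≤ expectation L g :=
  EReal.sub_le_sub
    (EReal.coe_ennreal_le_coe_ennreal_iff.mpr
      (lintegral_mono fun e => EReal.toENNReal_le_toENNReal (h e)))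
    (EReal.coe_ennreal_le_coe_ennreal_iff.mpr
      (lintegral_mono fun e => EReal.toENNReal_le_toENNReal (EReal.neg_le_neg_iff.mpr (h e))))

theorem expectation_coe {g : (Fin d → ℝ) → ℝ} (hg : Integrable g L) :
    expectation L (fun e => (g e : EReal)) = ((∫ e, g e ∂L : ℝ) : EReal) := by
  have h₁ : ∫⁻ e, ENNReal.ofReal (g e) ∂L ≠ ∞ := hg.lintegral_lt_top.ne
  have h₂ : ∫⁻ e, ENNReal.ofReal (-g e) ∂L ≠ ∞ := hg.neg.lintegral_lt_top.ne
  rw [integral_eq_lintegral_pos_part_sub_lintegral_neg_part hg, EReal.coe_sub,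
    EReal.coe_ennreal_toReal h₁, EReal.coe_ennreal_toReal h₂]
  simp only [expectation, ← EReal.coe_neg, EReal.real_coe_toENNReal]

theorem exists_coupling_of_wasserstein1_lt {μ ν : Measure (Fin d → ℝ)} {r : ℝ≥0∞}
    (h : wasserstein1 μ ν < r) :
    ∃ γ ∈ couplings μ ν, ∫⁻ p, ENNReal.ofReal (l1Dist p.1 p.2) ∂γ < r := by
  simpa only [wasserstein1, iInf_lt_iff, exists_prop] using h

theorem wasserstein1_self (μ : Measure (Fin d → ℝ)) : wasserstein1 μ μ = 0 := by
  have hdiag : Measurable fun e : Fin d → ℝ => (e, e) := by fun_prop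
  refine le_antisymm (iInf₂_le_of_le (μ.map fun e => (e, e)) ⟨?_, ?_⟩ ?_) zero_le
  · rw [Measure.map_map measurable_fst hdiag]
    exact Measure.map_id
  · rw [Measure.map_map measurable_snd hdiag]
    exact Measure.map_id
  · rw [lintegral_map (by exact continuous_l1Dist.measurable.ennreal_ofReal) hdiag]
    simp [l1Dist]

/-- Kantorovich's inequality for functions with an `ℓ¹` Lipschitz bound. -/
theorem integrable_and_integral_le_of_wasserstein1_le {μ ν : Measure (Fin d → ℝ)}
    {g : (Fin d → ℝ) → ℝ} {c r : ℝ} (hc : 0 ≤ c) (hr : 0 ≤ r)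
    (hg : ∀ a b, g a ≤ g b + c * l1Dist a b) (hν : Integrable g ν)
    (hW : wasserstein1 μ ν ≤ ENNReal.ofReal r) :
    Integrable g μ ∧ ∫ e, g e ∂μ ≤ ∫ e, g e ∂ν + c * r := by
  have hgc := continuous_of_le_l1Dist hc hg
  -- The slack `ε` avoids the need for an optimal coupling.
  have key : ∀ ε > 0, Integrable g μ ∧ ∫ e, g e ∂μ ≤ ∫ e, g e ∂ν + c * (r + ε) := by
    intro ε hε
    obtain ⟨γ, ⟨rfl, rfl⟩, hcost⟩ := exists_coupling_of_wasserstein1_lt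
      (hW.trans_lt ((ENNReal.ofReal_lt_ofReal_iff (by linarith)).mpr (lt_add_of_pos_right r hε)))
    have hl : Integrable (fun p : (Fin d → ℝ) × (Fin d → ℝ) => l1Dist p.1 p.2) γ := by
      refine (lintegral_ofReal_ne_top_iff_integrable
        continuous_l1Dist.aestronglyMeasurable (.of_forall fun p => l1Dist_nonneg _ _)).mp ?_
      exact (hcost.trans ENNReal.ofReal_lt_top).ne
    have hlint : ∫ p, l1Dist p.1 p.2 ∂γ ≤ r + ε := by
      rw [integral_eq_lintegral_of_nonneg_ae (.of_forall fun p => l1Dist_nonneg _ _)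
        continuous_l1Dist.aestronglyMeasurable]
      exact ENNReal.toReal_le_of_le_ofReal (by linarith) hcost.le
    have h₂ : Integrable (fun p : (Fin d → ℝ) × (Fin d → ℝ) => g p.2) γ :=
      (integrable_map_measure hgc.aestronglyMeasurable measurable_snd.aemeasurable).mp hν
    have h₁ : Integrable (fun p : (Fin d → ℝ) × (Fin d → ℝ) => g p.1) γ := by
      -- The Lipschitz bound, used in both directions, dominates `|g p.1|` by `|g p.2| + c * l1Dist
      -- p.1 p.2`.
      refine (h₂.norm.add (hl.const_mul c)).mono'
        (hgc.comp continuous_fst).aestronglyMeasurable (.of_forall fun p => ?_)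
      have ha := hg p.1 p.2
      have hb := hg p.2 p.1
      rw [l1Dist_comm] at hb
      simp only [Pi.add_apply, Real.norm_eq_abs]
      rw [abs_le]
      constructor
      · linarith [neg_abs_le (g p.2)]
      · linarith [le_abs_self (g p.2)]
    refine ⟨(integrable_map_measure hgc.aestronglyMeasurable measurable_fst.aemeasurable).mpr h₁, ?_⟩
    rw [integral_map measurable_fst.aemeasurable hgc.aestronglyMeasurable,
      integral_map measurable_snd.aemeasurable hgc.aestronglyMeasurable]
    calc ∫ p, g p.1 ∂γ ≤ ∫ p, (g p.2 + c * l1Dist p.1 p.2) ∂γ :=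
          integral_mono h₁ (h₂.add (hl.const_mul c)) fun p => hg _ _
      _ = ∫ p, g p.2 ∂γ + c * ∫ p, l1Dist p.1 p.2 ∂γ := by
          rw [integral_add h₂ (hl.const_mul c), integral_const_mul]
      _ ≤ _ := by gcongr
  refine ⟨(key 1 one_pos).1, le_of_forall_pos_le_add fun ε hε => ?_⟩
  have hc1 : 0 < c + 1 := by linarith
  -- Dividing by `c + 1` rather than `c` covers `c = 0`.
  have h := (key (ε / (c + 1)) (by positivity)).2
  have : c * (ε / (c + 1)) ≤ ε := by
    rw [mul_div_assoc', div_le_iff₀ hc1]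
    nlinarith
  linarith

/-- Moving the fraction `θ` of every atom of a uniform distribution along a vector `v` costs at
most `θ * ‖v‖₁`. -/
theorem wasserstein1_shift_le {n : ℕ} (hn : 0 < n) (x : Fin n → Fin d → ℝ) (v : Fin d → ℝ)
    {θ : ℝ} (h0 : 0 ≤ θ) (h1 : θ ≤ 1) :
    wasserstein1 (ENNReal.ofReal (1 - θ) • uniformDirac x +
        ENNReal.ofReal θ • uniformDirac (fun k => x k + v)) (uniformDirac x) ≤
      ENNReal.ofReal (θ * ∑ i, |v i|) := by
  refine iInf₂_le_of_le (ENNReal.ofReal (1 - θ) • uniformDirac (fun k => (x k, x k)) +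
        ENNReal.ofReal θ • uniformDirac (fun k => (x k + v, x k))) ⟨?_, ?_⟩ ?_
  · rw [Measure.map_add _ _ measurable_fst, Measure.map_smul, Measure.map_smul,
      map_uniformDirac _ measurable_fst, map_uniformDirac _ measurable_fst]
    rfl
  · rw [Measure.map_add _ _ measurable_snd, Measure.map_smul, Measure.map_smul,
      map_uniformDirac _ measurable_snd, map_uniformDirac _ measurable_snd]
    change _ • uniformDirac x + _ • uniformDirac x = _
    rw [← add_smul, ← ENNReal.ofReal_add (by linarith) h0, sub_add_cancel, ENNReal.ofReal_one, one_smul]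
  · rw [lintegral_add_measure, lintegral_smul_measure, lintegral_smul_measure,
      lintegral_uniformDirac, lintegral_uniformDirac]
    have hn0 : (n : ℝ≥0∞) ≠ 0 := by exact_mod_cast hn.ne'
    simp only [l1Dist, sub_self, abs_zero, Finset.sum_const_zero, ENNReal.ofReal_zero, mul_zero,
      smul_eq_mul, zero_add, Pi.add_apply, add_sub_cancel_left, Finset.sum_const,
      Finset.card_univ, Fintype.card_fin, nsmul_eq_mul]
    rw [← mul_assoc (n : ℝ≥0∞)⁻¹, ENNReal.inv_mul_cancel hn0 (ENNReal.natCast_ne_top n), one_mul,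
      ENNReal.ofReal_mul h0]

end Expectation

/-! ### Bounds and attainment for the second-stage value -/

namespace TwoStage

variable {dx dy dz dw M n : ℕ} {P : TwoStage dx dy dz dw M n}

theorem empirical_eq : P.empirical = uniformDirac P.residual := rfl

theorem H_le {z : Fin dz → ℝ} {y : Fin dy → ℝ} {w : Fin dw → ℝ}
    (hw : P.T z *ᵥ y + P.h z ≤ P.W *ᵥ w) : P.H z y ≤ ((P.q ⬝ᵥ w : ℝ) : EReal) :=
  iInf₂_le w hw

theorem le_H {p : Fin M → ℝ} (hp : p ∈ P.dualFeasible) (z : Fin dz → ℝ) (y : Fin dy → ℝ) :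
    ((p ⬝ᵥ (P.T z *ᵥ y + P.h z) : ℝ) : EReal) ≤ P.H z y :=
  le_iInf₂ fun _ hw => EReal.coe_le_coe_iff.mpr (dotProduct_le_of_dual_feasible hp.1 hp.2 hw)

theorem bot_lt_H (hdual : P.SufficientlyExpensiveRecourse) (z : Fin dz → ℝ) (y : Fin dy → ℝ) :
    ⊥ < P.H z y := by
  obtain ⟨p, hp⟩ := hdual
  exact (EReal.bot_lt_coe _).trans_le (le_H hp z y)

theorem exists_optimal_recourse (hdual : P.SufficientlyExpensiveRecourse) {z : Fin dz → ℝ}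
    {y : Fin dy → ℝ} (hH : P.H z y < ⊤) :
    ∃ w, P.T z *ᵥ y + P.h z ≤ P.W *ᵥ w ∧ ((P.q ⬝ᵥ w : ℝ) : EReal) = P.H z y := by
  have hcoe := EReal.coe_toReal hH.ne (bot_lt_H hdual z y).ne'
  obtain ⟨p₀, hp₀⟩ := hdual
  obtain ⟨w, hw, hq⟩ := exists_primal_le_of_forall_dual_le P.W P.q (P.T z *ᵥ y + P.h z)
    (P.H z y).toReal hp₀.1 hp₀.2 fun p h0 hpq => by
      rw [← EReal.coe_le_coe_iff, hcoe]
      exact le_H ⟨h0, hpq⟩ z y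
  refine ⟨w, hw, le_antisymm ?_ (H_le hw)⟩
  rw [← hcoe]
  exact EReal.coe_le_coe_iff.mpr hq

/-! ### Upper bound: feasible points dominate the worst case -/

section Upper

variable {v : Vars dy dz dw n}

/-- A recourse decision at `y'` is repaired at `y` by the columns `φ`, `ψ`. -/
theorem ReformFeasible.exists_recourse (hv : P.ReformFeasible v) {y y' : Fin dy → ℝ}
    {w : Fin dw → ℝ} (hw : P.T v.z *ᵥ y' + P.h v.z ≤ P.W *ᵥ w) :
    ∃ w', P.T v.z *ᵥ y + P.h v.z ≤ P.W *ᵥ w' ∧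
      P.q ⬝ᵥ w' ≤ P.q ⬝ᵥ w + v.lam * l1Dist y y' := by
  -- Each coordinate of `y - y'` is split into its positive part, paid for by `φ m`, and its
  -- negative part, paid for by `ψ m`.
  refine ⟨w + ∑ m, ((y m - y' m)⁺ • v.φ m + (y m - y' m)⁻ • v.ψ m), fun i => ?_, ?_⟩
  · have hsum : (P.T v.z *ᵥ y) i =
        (P.T v.z *ᵥ y') i + ∑ m, (y m - y' m) * (P.T v.z *ᵥ Pi.single m (1 : ℝ)) i := by
      simp only [Matrix.mulVec_single_one, Matrix.col_apply]
      simp only [Matrix.mulVec, dotProduct]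
      rw [← Finset.sum_add_distrib]
      exact Finset.sum_congr rfl fun m _ => by ring
    have hstep : ∑ m, (y m - y' m) * (P.T v.z *ᵥ Pi.single m (1 : ℝ)) i ≤
        ∑ m, ((y m - y' m)⁺ * (P.W *ᵥ v.φ m) i + (y m - y' m)⁻ * (P.W *ᵥ v.ψ m) i) := by
      refine Finset.sum_le_sum fun m _ => ?_
      have h₁ := mul_le_mul_of_nonneg_left (hv.constr_φ m i) (posPart_nonneg (y m - y' m))
      have h₂ := mul_le_mul_of_nonneg_left (hv.constr_ψ m i) (negPart_nonneg (y m - y' m))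
      rw [Pi.neg_apply] at h₂
      have h₃ := posPart_sub_negPart (y m - y' m)
      calc (y m - y' m) * (P.T v.z *ᵥ Pi.single m (1 : ℝ)) i
          = ((y m - y' m)⁺ - (y m - y' m)⁻) * (P.T v.z *ᵥ Pi.single m (1 : ℝ)) i := by rw [h₃]
        _ ≤ _ := by linarith
    have hi := hw i
    simp only [Pi.add_apply] at hi
    simp only [Matrix.mulVec_add, Matrix.mulVec_sum, Matrix.mulVec_smul, Pi.add_apply,
      Finset.sum_apply, Pi.smul_apply, smul_eq_mul]
    linarith
  · rw [dotProduct_add, dotProduct_sum, l1Dist, Finset.mul_sum]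
    gcongr with m
    rw [dotProduct_add, dotProduct_smul, dotProduct_smul, smul_eq_mul, smul_eq_mul,
      ← posPart_add_negPart (y m - y' m)]
    have h₁ := mul_le_mul_of_nonneg_left (hv.cost_φ m) (posPart_nonneg (y m - y' m))
    have h₂ := mul_le_mul_of_nonneg_left (hv.cost_ψ m) (negPart_nonneg (y m - y' m))
    linarith

theorem robustObj_le_reformObj (hn : 0 < n) (hdual : P.SufficientlyExpensiveRecourse)
    (hξ : 0 ≤ P.ξ) (hv : P.ReformFeasible v) :
    P.robustObj v.z ≤ ((P.reformObj v : ℝ) : EReal) := by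
  -- Recourse at a single residual, repaired by the columns, gives recourse at every realization.
  have hfin : ∀ y, P.H v.z y < ⊤ := fun y => by
    obtain ⟨w', hw', -⟩ := hv.exists_recourse (y := y) (hv.secondStage ⟨0, hn⟩)
    exact (H_le hw').trans_lt (EReal.coe_lt_top _)
  set g : (Fin dy → ℝ) → ℝ := fun e => (P.H v.z (P.fhat P.x v.z + e)).toReal with hg
  have hcoe : (fun e => P.H v.z (P.fhat P.x v.z + e)) = fun e => (g e : EReal) :=
    funext fun e => (EReal.coe_toReal (hfin _).ne (bot_lt_H hdual _ _).ne').symm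
  have hlip : ∀ a b, g a ≤ g b + v.lam * l1Dist a b := fun a b => by
    obtain ⟨w, hw, hwH⟩ := exists_optimal_recourse hdual (hfin (P.fhat P.x v.z + b))
    obtain ⟨w', hw', hle⟩ := hv.exists_recourse (y := P.fhat P.x v.z + a) hw
    have h₁ := (H_le hw').trans (EReal.coe_le_coe_iff.mpr hle)
    rw [congrFun hcoe a, EReal.coe_le_coe_iff] at h₁
    rw [congrFun hcoe b, EReal.coe_eq_coe_iff] at hwH
    rw [hwH] at h₁
    simpa [l1Dist] using h₁
  have hsup : ⨆ L ∈ P.ambiguitySet, expectation L (fun e => P.H v.z (P.fhat P.x v.z + e)) ≤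
      ((v.lam * P.ξ + 1 / (n : ℝ) * ∑ k, P.q ⬝ᵥ v.ω k : ℝ) : EReal) := by
    refine iSup₂_le fun L hL => ?_
    obtain ⟨hint, hle⟩ := integrable_and_integral_le_of_wasserstein1_le hv.lam_nonneg hξ hlip
      (integrable_uniformDirac P.residual hn g) hL.2
    rw [hcoe, expectation_coe hint, EReal.coe_le_coe_iff]
    rw [integral_uniformDirac] at hle
    refine hle.trans ?_
    rw [add_comm]
    gcongr with k
    have := H_le (hv.secondStage k)
    rwa [congrFun hcoe, EReal.coe_le_coe_iff] at this
  calc P.robustObj v.z ≤ ((P.c ⬝ᵥ v.z : ℝ) : EReal) +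
        ((v.lam * P.ξ + 1 / (n : ℝ) * ∑ k, P.q ⬝ᵥ v.ω k : ℝ) : EReal) := by
        unfold robustObj
        gcongr
    _ = _ := by rw [← EReal.coe_add, reformObj, add_assoc]

end Upper

/-! ### Lower bound: worst-case distributions and multipliers -/

section Lower

variable {z : Fin dz → ℝ}

/-- The worst-case expected recourse cost. -/
def worstCase (P : TwoStage dx dy dz dw M n) (z : Fin dz → ℝ) : EReal :=
  ⨆ L ∈ P.ambiguitySet, expectation L (fun e => P.H z (P.fhat P.x z + e))

/-- Passing to integrable real minorants makes measurability of `H` unnecessary. -/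
theorem integral_le_worstCase {L : Measure (Fin dy → ℝ)} (hL : L ∈ P.ambiguitySet)
    {g : (Fin dy → ℝ) → ℝ} (hg : Integrable g L)
    (hgH : ∀ e, (g e : EReal) ≤ P.H z (P.fhat P.x z + e)) :
    ((∫ e, g e ∂L : ℝ) : EReal) ≤ P.worstCase z := by
  rw [← expectation_coe hg]
  exact (expectation_mono hgH).trans
    (le_iSup₂ (f := fun L (_ : L ∈ P.ambiguitySet) =>
      expectation L (fun e => P.H z (P.fhat P.x z + e))) L hL)

theorem empirical_mem_ambiguitySet (hn : 0 < n) : P.empirical ∈ P.ambiguitySet :=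
  ⟨isProbabilityMeasure_uniformDirac _ hn, by rw [wasserstein1_self]; exact zero_le⟩

/-- The empirical distribution lies in the ball and gives each residual positive mass, so an
infinite value there makes its expectation `⊤`; the negative part is finite by dual feasibility. -/
theorem H_residual_lt_top (hn : 0 < n) (hdual : P.SufficientlyExpensiveRecourse)
    (hlt : P.worstCase z < ⊤) (k : Fin n) : P.H z (P.fhat P.x z + P.residual k) < ⊤ := by
  by_contra hcon
  refine hlt.not_ge ((le_of_eq ?_).trans (le_iSup₂ (f := fun L (_ : L ∈ P.ambiguitySet) =>
    expectation L (fun e => P.H z (P.fhat P.x z + e))) _ (empirical_mem_ambiguitySet hn)))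
  have hninv : (n : ℝ≥0∞)⁻¹ ≠ 0 := ENNReal.inv_ne_zero.mpr (ENNReal.natCast_ne_top n)
  rw [expectation, empirical_eq, lintegral_uniformDirac, lintegral_uniformDirac]
  have hpos : ∑ k, (P.H z (P.fhat P.x z + P.residual k)).toENNReal = ⊤ :=
    ENNReal.sum_eq_top.mpr ⟨k, Finset.mem_univ _,
      EReal.toENNReal_eq_top_iff.mpr (not_lt_top_iff.mp hcon)⟩
  have hneg : (n : ℝ≥0∞)⁻¹ * ∑ k, (-P.H z (P.fhat P.x z + P.residual k)).toENNReal ≠ ⊤ := by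
    refine ENNReal.mul_ne_top (ENNReal.inv_ne_top.mpr (by exact_mod_cast hn.ne'))
      (ENNReal.sum_ne_top.mpr fun k _ => EReal.toENNReal_ne_top_iff.mpr ?_)
    rw [Ne, EReal.neg_eq_top_iff]
    exact (bot_lt_H hdual _ _).ne'
  rw [hpos, ENNReal.mul_top hninv, EReal.coe_ennreal_top, EReal.top_sub]
  exact mt EReal.coe_ennreal_eq_top_iff.mp hneg

/-- Mass escaping to infinity along `v` shows that the dual slope in direction `v` is paid. -/
theorem mean_add_slope_le_worstCase (hn : 0 < n) {p : Fin M → ℝ} (hp : p ∈ P.dualFeasible)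
    (hξ : 0 < P.ξ) {G : Fin n → ℝ} (hG : ∀ k, P.H z (P.fhat P.x z + P.residual k) = G k)
    {B : ℝ} (hB : P.worstCase z ≤ B) {v : Fin dy → ℝ} (hv : ∑ i, |v i| = 1) :
    1 / (n : ℝ) * ∑ k, G k + P.ξ * (p ⬝ᵥ (P.T z *ᵥ v)) ≤ B := by
  set a : (Fin dy → ℝ) → ℝ := fun e => p ⬝ᵥ (P.T z *ᵥ (P.fhat P.x z + e) + P.h z) with ha
  have ha_add : ∀ e (t : ℝ), a (e + t • v) = a e + t * (p ⬝ᵥ (P.T z *ᵥ v)) := fun e t => by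
    simp only [ha, Matrix.mulVec_add, Matrix.mulVec_smul, dotProduct_add, dotProduct_smul,
      smul_eq_mul]
    ring
  -- Where recourse is infeasible, the dual affine minorant `a` replaces `⊤`, so `g` is real, lies
  -- below `H` and still dominates `a`.
  set g : (Fin dy → ℝ) → ℝ := fun e =>
    if P.H z (P.fhat P.x z + e) = ⊤ then a e else (P.H z (P.fhat P.x z + e)).toReal with hg
  have hbot : ∀ y, P.H z y ≠ ⊥ := fun y => (bot_lt_H ⟨p, hp⟩ z y).ne'
  have hgH : ∀ e, (g e : EReal) ≤ P.H z (P.fhat P.x z + e) := fun e => by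
    simp only [hg]
    split_ifs with h
    · rw [h]; exact le_top
    · exact (EReal.coe_toReal h (hbot _)).le
  have hag : ∀ e, a e ≤ g e := fun e => by
    simp only [hg]
    split_ifs with h
    · exact le_rfl
    · rw [← EReal.coe_le_coe_iff, EReal.coe_toReal h (hbot _)]
      exact le_H hp _ _
  have hgG : ∀ k, g (P.residual k) = G k := fun k => by simp [hg, hG k]
  have hn' : (0 : ℝ) < n := by exact_mod_cast hn
  set s := p ⬝ᵥ (P.T z *ᵥ v)
  set m₁ := 1 / (n : ℝ) * ∑ k, G k
  set m₀ := 1 / (n : ℝ) * ∑ k, a (P.residual k)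
  -- Mass `θ` moved by `ξ / θ` spends exactly the budget `ξ`; the gain `ξ * s` does not depend on
  -- `θ`.
  have key : ∀ θ : ℝ, 0 < θ → θ ≤ 1 → (1 - θ) * m₁ + θ * m₀ + P.ξ * s ≤ B := by
    intro θ h0 h1
    set x' : Fin n → Fin dy → ℝ := fun k => P.residual k + (P.ξ / θ) • v
    set L := ENNReal.ofReal (1 - θ) • uniformDirac P.residual +
      ENNReal.ofReal θ • uniformDirac x'
    have hL : L ∈ P.ambiguitySet := by
      constructor
      · have := isProbabilityMeasure_uniformDirac P.residual hn
        have := isProbabilityMeasure_uniformDirac x' hn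
        constructor
        simp only [L, Measure.add_apply, Measure.smul_apply, measure_univ, smul_eq_mul, mul_one]
        rw [← ENNReal.ofReal_add (by linarith) h0.le, sub_add_cancel, ENNReal.ofReal_one]
      · refine (wasserstein1_shift_le hn P.residual ((P.ξ / θ) • v) h0.le h1).trans (le_of_eq ?_)
        congr 1
        simp only [Pi.smul_apply, smul_eq_mul, abs_mul, ← Finset.mul_sum, hv, mul_one]
        rw [abs_of_pos (by positivity)]
        field_simp
    have hi₁ := (integrable_uniformDirac P.residual hn g).smul_measure
      (ENNReal.ofReal_ne_top (r := 1 - θ))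
    have hi₂ := (integrable_uniformDirac x' hn g).smul_measure (ENNReal.ofReal_ne_top (r := θ))
    have hle := (integral_le_worstCase hL (hi₁.add_measure hi₂) hgH).trans hB
    rw [EReal.coe_le_coe_iff, integral_add_measure hi₁ hi₂, integral_smul_measure,
      integral_smul_measure, integral_uniformDirac, integral_uniformDirac,
      ENNReal.toReal_ofReal (by linarith), ENNReal.toReal_ofReal h0.le] at hle
    simp only [hgG, smul_eq_mul] at hle
    have hmean : m₀ + P.ξ / θ * s ≤ 1 / (n : ℝ) * ∑ k, g (x' k) := by
      calc m₀ + P.ξ / θ * s = 1 / (n : ℝ) * ∑ k, a (x' k) := by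
            simp only [x', ha_add, Finset.sum_add_distrib, Finset.sum_const, Finset.card_univ,
              Fintype.card_fin, nsmul_eq_mul, m₀]
            field_simp
        _ ≤ _ := by
            gcongr with k
            exact hag _
    have := mul_le_mul_of_nonneg_left hmean h0.le
    have hθ : θ * (m₀ + P.ξ / θ * s) = θ * m₀ + P.ξ * s := by field_simp
    linarith
  refine le_of_forall_pos_le_add fun ε hε => ?_
  -- Taking `θ = min 1 (ε / D)` keeps the loss `θ * (m₁ - m₀)` below `ε`; the added 1 makes `D`
  -- positive.
  set D := |m₀ - m₁| + 1
  have hD : 0 < D := by positivity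
  have h0 : 0 < min 1 (ε / D) := lt_min one_pos (by positivity)
  have h₁ := key _ h0 (min_le_left _ _)
  have h₂ : min 1 (ε / D) * (m₁ - m₀) ≤ ε := by
    calc min 1 (ε / D) * (m₁ - m₀) ≤ min 1 (ε / D) * D := by
          gcongr
          linarith [neg_abs_le (m₀ - m₁)]
      _ ≤ ε / D * D := by gcongr; exact min_le_right _ _
      _ = ε := div_mul_cancel₀ _ hD.ne'
  linarith

/-- Relatively complete recourse provides recourse for both signs of every direction. -/
theorem RelativelyCompleteRecourse.exists_le_mulVec (hrec : P.RelativelyCompleteRecourse)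
    (hz : z ∈ P.Z) (v : Fin dy → ℝ) : ∃ w, P.T z *ᵥ v ≤ P.W *ᵥ w := by
  -- With zero cost, duality reduces feasibility to `p ⬝ᵥ T(z) v ≤ 0` for all `p ≥ 0` with `Wᵀ p =
  -- 0`. Recourse at every multiple `t • v` bounds a function affine in `t`, so its slope vanishes.
  obtain ⟨w, hw, -⟩ := exists_primal_le_of_forall_dual_le P.W 0 (P.T z *ᵥ v) 0
    (p₀ := 0) le_rfl (Matrix.mulVec_zero _) fun p hp hpq => by
      have hbd : ∀ t : ℝ, t * (p ⬝ᵥ (P.T z *ᵥ v)) + p ⬝ᵥ P.h z ≤ 0 := fun t => by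
        obtain ⟨w, hw⟩ := hrec z hz (t • v)
        have := dotProduct_le_of_dual_feasible hp hpq hw
        rwa [dotProduct_add, Matrix.mulVec_smul, dotProduct_smul, zero_dotProduct,
          smul_eq_mul] at this
      by_contra! hpos
      have := hbd ((1 - p ⬝ᵥ P.h z) / (p ⬝ᵥ (P.T z *ᵥ v)))
      rw [div_mul_cancel₀ _ hpos.ne'] at this
      linarith
  exact ⟨w, hw⟩

theorem mean_le_worstCase (hn : 0 < n) {G : Fin n → ℝ}
    (hG : ∀ k, P.H z (P.fhat P.x z + P.residual k) = G k)
    (hdual : P.SufficientlyExpensiveRecourse) {B : ℝ} (hB : P.worstCase z = B) :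
    1 / (n : ℝ) * ∑ k, G k ≤ B := by
  obtain ⟨p, hp⟩ := id hdual
  -- The default 0 is harmless: `H` is finite at the residuals, which carry all the mass.
  set g : (Fin dy → ℝ) → ℝ := fun e => if P.H z (P.fhat P.x z + e) = ⊤ then 0
    else (P.H z (P.fhat P.x z + e)).toReal with hg
  have hgH : ∀ e, (g e : EReal) ≤ P.H z (P.fhat P.x z + e) := fun e => by
    simp only [hg]
    split_ifs with h
    · rw [h]; exact le_top
    · exact (EReal.coe_toReal h (bot_lt_H hdual _ _).ne').le
  have hgG : ∀ k, g (P.residual k) = G k := fun k => by simp [hg, hG k]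
  have := integral_le_worstCase (empirical_mem_ambiguitySet hn)
    (integrable_uniformDirac P.residual hn g) hgH
  rw [empirical_eq, integral_uniformDirac, hB, EReal.coe_le_coe_iff] at this
  simpa only [hgG] using this

/-- The certificate at radius zero, where the size of the multiplier does not matter. -/
theorem RelativelyCompleteRecourse.exists_multiplier (hrec : P.RelativelyCompleteRecourse)
    (hz : z ∈ P.Z) :
    ∃ l, 0 ≤ l ∧
      (∀ m, ∃ w, P.q ⬝ᵥ w ≤ l ∧ P.T z *ᵥ Pi.single m (1 : ℝ) ≤ P.W *ᵥ w) ∧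
      (∀ m, ∃ w, P.q ⬝ᵥ w ≤ l ∧ -(P.T z *ᵥ Pi.single m (1 : ℝ)) ≤ P.W *ᵥ w) := by
  choose φ hφ using fun m => hrec.exists_le_mulVec hz (Pi.single m (1 : ℝ))
  choose ψ hψ using fun m => hrec.exists_le_mulVec hz (-Pi.single m (1 : ℝ))
  have hsum : ∀ (f : Fin dy → Fin dw → ℝ) m, P.q ⬝ᵥ f m ≤ ∑ m, |P.q ⬝ᵥ f m| := fun f m =>
    (le_abs_self _).trans
      (Finset.single_le_sum (f := fun m => |P.q ⬝ᵥ f m|) (fun _ _ => abs_nonneg _)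
        (Finset.mem_univ m))
  have hnn : ∀ f : Fin dy → Fin dw → ℝ, 0 ≤ ∑ m, |P.q ⬝ᵥ f m| := fun f =>
    Finset.sum_nonneg fun _ _ => abs_nonneg _
  refine ⟨∑ m, |P.q ⬝ᵥ φ m| + ∑ m, |P.q ⬝ᵥ ψ m|, add_nonneg (hnn φ) (hnn ψ),
    fun m => ⟨φ m, ?_, hφ m⟩, fun m => ⟨ψ m, ?_, ?_⟩⟩
  · linarith [hsum φ m, hnn ψ]
  · linarith [hsum ψ m, hnn φ]
  · rw [← Matrix.mulVec_neg]
    exact hψ m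

/-- A multiplier for the radius together with the columns that certify it. -/
theorem exists_multiplier (hn : 0 < n) (hdual : P.SufficientlyExpensiveRecourse)
    (hξ : 0 ≤ P.ξ) (hξ_zero : P.ξ = 0 → P.RelativelyCompleteRecourse) (hz : z ∈ P.Z)
    {G : Fin n → ℝ} (hG : ∀ k, P.H z (P.fhat P.x z + P.residual k) = G k)
    {B : ℝ} (hB : P.worstCase z = B) :
    ∃ l, 0 ≤ l ∧ 1 / (n : ℝ) * ∑ k, G k + l * P.ξ ≤ B ∧
      (∀ m, ∃ w, P.q ⬝ᵥ w ≤ l ∧ P.T z *ᵥ Pi.single m (1 : ℝ) ≤ P.W *ᵥ w) ∧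
      (∀ m, ∃ w, P.q ⬝ᵥ w ≤ l ∧ -(P.T z *ᵥ Pi.single m (1 : ℝ)) ≤ P.W *ᵥ w) := by
  have hmean := mean_le_worstCase hn hG hdual hB
  obtain ⟨p₀, hp₀⟩ := hdual
  rcases hξ.eq_or_lt with h0 | hpos
  · obtain ⟨l, hl, hφ, hψ⟩ := (hξ_zero h0.symm).exists_multiplier hz
    exact ⟨l, hl, by rwa [← h0, mul_zero, add_zero], hφ, hψ⟩
  -- This `l` makes the mean plus `l * ξ` equal to `B`.
  · set l := (B - 1 / (n : ℝ) * ∑ k, G k) / P.ξ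
    have hlξ : l * P.ξ = B - 1 / (n : ℝ) * ∑ k, G k := div_mul_cancel₀ _ hpos.ne'
    have hdir : ∀ v : Fin dy → ℝ, ∑ i, |v i| = 1 →
        ∃ w, P.q ⬝ᵥ w ≤ l ∧ P.T z *ᵥ v ≤ P.W *ᵥ w := by
      intro v hv
      obtain ⟨w, hw, hq⟩ := exists_primal_le_of_forall_dual_le P.W P.q (P.T z *ᵥ v)
        l hp₀.1 hp₀.2 fun p hp hpq => by
          rw [le_div_iff₀ hpos]
          linarith [mean_add_slope_le_worstCase hn ⟨hp, hpq⟩ hpos hG hB.le hv]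
      exact ⟨w, hq, hw⟩
    have habs : ∀ m : Fin dy, ∑ i, |(Pi.single m (1 : ℝ) : Fin dy → ℝ) i| = 1 := fun m => by
      simp [Pi.single_apply, apply_ite abs]
    have hneg : ∀ m : Fin dy, ∑ i, |(-Pi.single m (1 : ℝ) : Fin dy → ℝ) i| = 1 := fun m => by
      simpa only [Pi.neg_apply, abs_neg] using habs m
    refine ⟨l, div_nonneg (sub_nonneg.mpr hmean) hξ, (add_eq_of_eq_sub' hlξ).le,
      fun m => hdir _ (habs m), fun m => ?_⟩
    rw [← Matrix.mulVec_neg]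
    exact hdir _ (hneg m)

theorem exists_reformFeasible_eq (hn : 0 < n) (hdual : P.SufficientlyExpensiveRecourse)
    (hξ : 0 ≤ P.ξ) (hξ_zero : P.ξ = 0 → P.RelativelyCompleteRecourse) (hz : z ∈ P.Z)
    (hlt : P.robustObj z < ⊤) :
    ∃ v, P.ReformFeasible v ∧ v.z = z ∧ ((P.reformObj v : ℝ) : EReal) = P.robustObj z := by
  have hobj : P.robustObj z = ((P.c ⬝ᵥ z : ℝ) : EReal) + P.worstCase z := rfl
  have hS : P.worstCase z < ⊤ := by
    rw [lt_top_iff_ne_top]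
    intro h
    rw [hobj, h, EReal.coe_add_top] at hlt
    exact lt_irrefl _ hlt
  have hex := fun k => exists_optimal_recourse hdual (H_residual_lt_top hn hdual hS k)
  choose ω hω hωH using hex
  -- An affine minorant from any dual point has a finite empirical mean.
  have hS' : P.worstCase z ≠ ⊥ := by
    obtain ⟨p, hp⟩ := id hdual
    have := integral_le_worstCase (z := z) (empirical_mem_ambiguitySet hn)
      (integrable_uniformDirac P.residual hn
        fun e => p ⬝ᵥ (P.T z *ᵥ (P.fhat P.x z + e) + P.h z))
      fun e => le_H hp z (P.fhat P.x z + e)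
    exact ((EReal.bot_lt_coe _).trans_le this).ne'
  have hB := (EReal.coe_toReal hS.ne hS').symm
  set B := (P.worstCase z).toReal
  obtain ⟨l, hl, hle, hφ, hψ⟩ := exists_multiplier hn hdual hξ hξ_zero hz
    (G := fun k => P.q ⬝ᵥ ω k) (fun k => (hωH k).symm) hB
  choose φ hφq hφ using hφ
  choose ψ hψq hψ using hψ
  have hfeas : P.ReformFeasible ⟨z, l, φ, ψ, ω⟩ := ⟨hz, hl, hφq, hψq, hφ, hψ, hω⟩
  have hval : P.reformObj ⟨z, l, φ, ψ, ω⟩ ≤ P.c ⬝ᵥ z + B := by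
    simp only [reformObj]
    linarith
  have hge := robustObj_le_reformObj hn hdual hξ hfeas
  have hle' : ((P.reformObj ⟨z, l, φ, ψ, ω⟩ : ℝ) : EReal) ≤ P.robustObj z := by
    rw [hobj, hB, ← EReal.coe_add]
    exact EReal.coe_le_coe_iff.mpr hval
  exact ⟨⟨z, l, φ, ψ, ω⟩, hfeas, rfl, le_antisymm hle' hge⟩

end Lower

end TwoStage

end ResidualDRO

end

/-! ### The reformulation theorem -/

theorem mainTheorem7 {dx dy dz dw M n : ℕ} (hn : 0 < n)
    (P : ResidualDRO.TwoStage dx dy dz dw M n)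
    (hdual : P.SufficientlyExpensiveRecourse)
    (hξ : 0 ≤ P.ξ) (hξ_zero : P.ξ = 0 → P.RelativelyCompleteRecourse) :
    -- the two problems have the same optimal value
    P.robustValue = P.reformValue ∧
    -- every feasible point of the finite problem bounds the worst-case cost of its decision,
    (∀ v, P.ReformFeasible v → P.robustObj v.z ≤ ((P.reformObj v : ℝ) : EReal)) ∧
    -- and every decision of finite worst-case cost extends to a feasible point of that cost
    (∀ z ∈ P.Z, P.robustObj z < ⊤ →
      ∃ v, P.ReformFeasible v ∧ v.z = z ∧ ((P.reformObj v : ℝ) : EReal) = P.robustObj z) ∧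
    -- the optimal first-stage decisions agree
    (∀ z, P.IsRobustOptimal z ↔ ∃ v, P.IsReformOptimal v ∧ v.z = z) := by
  have hup := fun v => ResidualDRO.TwoStage.robustObj_le_reformObj (P := P) (v := v) hn hdual hξ
  have hlow := fun z (hz : z ∈ P.Z) =>
    ResidualDRO.TwoStage.exists_reformFeasible_eq hn hdual hξ hξ_zero hz
  refine ⟨le_antisymm ?_ ?_, hup, hlow, fun z => ⟨?_, ?_⟩⟩
  · exact le_iInf₂ fun v hv => iInf₂_le_of_le v.z hv.z_mem (hup v hv)
  · refine le_iInf₂ fun z hz => ?_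
    rcases eq_or_ne (P.robustObj z) ⊤ with htop | hne
    · rw [htop]
      exact le_top
    · obtain ⟨v, hv, -, hval⟩ := hlow z hz hne.lt_top
      exact iInf₂_le_of_le v hv hval.le
  · rintro ⟨hz, hlt, hopt⟩
    obtain ⟨v, hv, hvz, hval⟩ := hlow z hz hlt
    refine ⟨v, ⟨hv, fun v' hv' => ?_⟩, hvz⟩
    rw [← EReal.coe_le_coe_iff, hval]
    exact (hopt _ hv'.z_mem).trans (hup v' hv')
  · rintro ⟨v, ⟨hv, hopt⟩, rfl⟩
    refine ⟨hv.z_mem, (hup v hv).trans_lt (EReal.coe_lt_top _), fun z' hz' => ?_⟩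
    rcases eq_or_ne (P.robustObj z') ⊤ with htop | hne
    · rw [htop]
      exact le_top
    · obtain ⟨v', hv', -, hval⟩ := hlow z' hz' hne.lt_top
      rw [← hval]
      exact (hup v hv).trans (EReal.coe_le_coe_iff.mpr (hopt v' hv'))
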